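/- Let $k\ge 2$ and let $n_1,\dots,n_k\ge 1$ be integers such that $n=\sum_{\ell=1}^k n_\ell$ is even. Let $G=K_{n_1,n_2,\dots,n_k}$ be the complete multipartite graph whose vertex set is the disjoint union of $V_1,\dots,V_k$ with $|V_\ell|=n_\ell$, two vertices being adjacent if and only if they lie in different parts. Let $\tau_o(G)$ be the number of odd spanning trees of $G$, that is, of spanning trees of $G$ in which every vertex has odd degree. Then $$\tau_o(G)=\frac{1}{2^{n}}\sum_{r_1=0}^{n_1}\sum_{r_2=0}^{n_2}\cdots\sum_{r_k=0}^{n_k}\left(\prod_{\ell=1}^{k}\binom{n_\ell}{r_\ell}\right)\left(\prod_{\ell=1}^{k}(M-m_\ell)^{n_{\ell}-1}\right)M^{k-2},$$ where, for each $(r_1,\dots,r_k)$, $m_\ell=2r_\ell-n_\ell$ for $1\le\ell\le k$ and $M=\sum_{\ell=1}^{k}m_\ell$, and where $0^0=1$. -/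

import Mathlib

/-- `τ_o(G)`: the number of odd spanning trees of `G`, i.e. of connected acyclic subgraphs of `G` on
the whole vertex set of `G` in which every vertex has odd degree. The degree of `v` in `T` is the
cardinality of its neighbourhood in `T`. -/
noncomputable def numOddSpanningTrees {V : Type*} [Finite V] (G : SimpleGraph V) : ℕ :=
  {T : SimpleGraph V | T ≤ G ∧ T.IsTree ∧ ∀ v, Odd (T.neighborSet v).ncard}.ncard

open MvPolynomial

/-! Let `treePoly` sum ∏ x_v^(deg v - 1) over spanning trees. Averaged over all x ∈ {±1}^V, a
monomial survives, with value 1, exactly when every exponent is even, that is, when the tree is odd.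
For a complete multipartite graph with S = ∑ x_v, `treePoly_comap_top` factors the polynomial as
S^(k-2) ∏_ℓ (S - S_ℓ)^(n_ℓ-1), where S_ℓ is the sum over part ℓ. If r_ℓ signs in part ℓ are +1, then
S_ℓ = m_ℓ and S = M; there are ∏ C(n_ℓ, r_ℓ) such choices.

The factorization goes by induction on |V|. Both sides are homogeneous of degree |V| - 2, so no
monomial involves every variable, and it suffices to compare them at x_v = 0 for each v. There only
trees with v as a leaf survive, and deleting the leaf gives (∑_{u ~ v} x_u) times the polynomial of
G - v (`killCompl_treePoly`). -/

open Finset in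
/-- A homogeneous polynomial of degree less than the number of variables vanishes as soon as it
vanishes whenever one of the variables is set to zero. -/
theorem MvPolynomial.IsHomogeneous.eq_zero_of_killCompl {V R : Type*} [Fintype V] [CommSemiring R]
    {p : MvPolynomial V R} {d : ℕ} (hp : p.IsHomogeneous d) (hd : d < Fintype.card V)
    (h : ∀ v : V, MvPolynomial.killCompl (Subtype.val_injective (p := (· ≠ v))) p = 0) : p = 0 := by
  classical
  ext s
  rw [coeff_zero]
  by_contra hs
  have hdeg : s.degree = d := by
    by_contra hne
    exact hs (hp.coeff_eq_zero hne)
  obtain ⟨v, hv⟩ : ∃ v, s v = 0 := by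
    by_contra! hne
    have : ∑ _v : V, 1 ≤ ∑ v, s v := sum_le_sum fun v _ => Nat.one_le_iff_ne_zero.2 (hne v)
    rw [Finsupp.degree_eq_sum] at hdeg
    simp at this
    omega
  have hsub : (s.support : Set V) ⊆ Set.range (Subtype.val : {w // w ≠ v} → V) := by
    intro w hw
    refine ⟨⟨w, ?_⟩, rfl⟩
    rintro rfl
    simp [hv] at hw
  have := coeff_killCompl (p := p) (Subtype.val_injective (p := (· ≠ v)))
    (s := s.comapDomain _ Subtype.val_injective.injOn)
  rw [Finsupp.mapDomain_comapDomain _ Subtype.val_injective _ hsub, h v, coeff_zero] at this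
  exact hs this.symm

/-! ### Attaching and removing leaves -/

namespace SimpleGraph

-- Removing a leaf costs one vertex and one edge, so for the converse connectedness together with
-- |E| + 1 = |V| carries over.
open scoped Classical in
theorem isTree_iff_isTree_induce_compl_singleton {V : Type*} [Fintype V] {T : SimpleGraph V}
    {v : V} (hv : T.degree v = 1) : T.IsTree ↔ (T.induce {v}ᶜ).IsTree := by
  constructor
  · exact fun h => ⟨h.1.induce_compl_singleton_of_degree_eq_one hv, h.2.induce _⟩
  · intro h
    obtain ⟨u, hvu, -⟩ := degree_eq_one_iff_existsUnique_adj.mp hv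
    have hu : ∀ w, T.Reachable u w := by
      intro w
      by_cases hw : w = v
      · subst hw
        exact hvu.symm.reachable
      · exact (h.1.preconnected ⟨u, hvu.ne'⟩ ⟨w, hw⟩).map (Embedding.induce _).toHom
    have hc : T.Connected := (connected_iff T).2 ⟨fun a b => (hu a).symm.trans (hu b), ⟨v⟩⟩
    have h1 := (isTree_iff_connected_and_card.1 h).2
    have h2 := T.card_edgeFinset_induce_compl_singleton v
    rw [T.card_edgeFinset_deleteIncidenceSet v, hv] at h2
    have h3 : 0 < T.edgeFinset.card :=
      Finset.card_pos.2 ⟨s(v, u), by simpa using hvu⟩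
    refine isTree_iff_connected_and_card.2 ⟨hc, ?_⟩
    have h4 : Nat.card ↑({v}ᶜ : Set V) + 1 = Nat.card V := by
      rw [Nat.card_coe_set_eq, Set.ncard_compl, Set.ncard_singleton]
      have : 0 < Nat.card V := Nat.card_pos_iff.2 ⟨⟨v⟩, inferInstance⟩
      omega
    rw [Nat.card_eq_fintype_card, ← edgeFinset_card] at h1 ⊢
    omega

end SimpleGraph

namespace SimpleGraph

/-- The finite set of spanning trees of `G`. -/
noncomputable def spanningTrees {V : Type*} [Finite V] (G : SimpleGraph V) :
    Finset (SimpleGraph V) :=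
  (Set.toFinite {T : SimpleGraph V | T ≤ G ∧ T.IsTree}).toFinset

@[simp]
theorem mem_spanningTrees {V : Type*} [Finite V] {G T : SimpleGraph V} :
    T ∈ G.spanningTrees ↔ T ≤ G ∧ T.IsTree := by
  simp [spanningTrees]

/-- The graph on `V` obtained from a graph on the vertices other than `v` by joining `v` to `u`
only. -/
def attachLeaf {V : Type*} {v : V} (H : SimpleGraph {w // w ≠ v}) (u : {w // w ≠ v}) :
    SimpleGraph V :=
  H.map (Function.Embedding.subtype _) ⊔ edge v u

theorem attachLeaf_adj_self {V : Type*} {v : V} (H : SimpleGraph {w // w ≠ v}) (u : {w // w ≠ v})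
    (w : V) : (H.attachLeaf u).Adj v w ↔ w = u := by
  have := u.2
  simp only [attachLeaf, sup_adj, map_adj, edge_adj]
  constructor
  · rintro (⟨a, b, -, h, -⟩ | h)
    · exact absurd h a.2
    · grind
  · rintro rfl
    exact Or.inr (by simp [u.2.symm])

theorem comap_attachLeaf {V : Type*} {v : V} (H : SimpleGraph {w // w ≠ v}) (u : {w // w ≠ v}) :
    (H.attachLeaf u).comap Subtype.val = H := by
  ext a b
  have := a.2
  have := b.2
  simp only [attachLeaf, comap_adj, sup_adj, map_adj, edge_adj]
  constructor
  · rintro (⟨x, y, h, hx, hy⟩ | h)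
    · rw [Subtype.ext hx, Subtype.ext hy] at h
      exact h
    · grind
  · exact fun h => Or.inl ⟨a, b, h, rfl, rfl⟩

theorem ext_of_comap_of_adj {V : Type*} {v : V} {T T' : SimpleGraph V}
    (h : T.comap (Subtype.val : {w // w ≠ v} → V) = T'.comap Subtype.val)
    (hv : ∀ w, T.Adj v w ↔ T'.Adj v w) : T = T' := by
  ext a b
  by_cases ha : a = v
  · rw [ha, hv]
  by_cases hb : b = v
  · rw [hb, adj_comm, hv, adj_comm]
  exact iff_of_eq (congrFun (congrFun (congrArg Adj h) ⟨a, ha⟩) ⟨b, hb⟩)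

open scoped Classical in
theorem degree_eq_degree_comap_add {V : Type*} [Fintype V] (T : SimpleGraph V) {v : V}
    (w : {w // w ≠ v}) :
    T.degree w = (T.comap (Subtype.val : {w // w ≠ v} → V)).degree w +
      if T.Adj v w then 1 else 0 := by
  rw [← card_neighborFinset_eq_degree, ← card_neighborFinset_eq_degree,
    ← Finset.card_map (Function.Embedding.subtype _)]
  split_ifs with h
  · rw [← Finset.card_insert_of_notMem (a := v)]
    · congr 1
      ext x
      by_cases hx : x = v
      · simp [hx, h.symm]
      · simp [hx]
    · simp
  · rw [add_zero]
    congr 1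
    ext x
    by_cases hx : x = v
    · simp [hx, adj_comm, h]
    · simp [hx]

open scoped Classical in
theorem degree_attachLeaf_self {V : Type*} [Fintype V] {v : V}
    (H : SimpleGraph {w // w ≠ v}) (u : {w // w ≠ v}) : (H.attachLeaf u).degree v = 1 :=
  degree_eq_one_iff_existsUnique_adj.2
    ⟨u, (attachLeaf_adj_self H u _).2 rfl, fun w hw => (attachLeaf_adj_self H u w).1 hw⟩

open scoped Classical in
theorem degree_attachLeaf_coe {V : Type*} [Fintype V] {v : V}
    (H : SimpleGraph {w // w ≠ v}) (u w : {w // w ≠ v}) :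
    (H.attachLeaf u).degree w = H.degree w + if w = u then 1 else 0 := by
  rw [degree_eq_degree_comap_add]
  congr 1
  · congr!
    exact comap_attachLeaf H u
  · simp only [attachLeaf_adj_self, Subtype.val_inj]

theorem isTree_attachLeaf {V : Type*} [Fintype V] {v : V}
    (H : SimpleGraph {w // w ≠ v}) (u : {w // w ≠ v}) : (H.attachLeaf u).IsTree ↔ H.IsTree := by
  classical
  rw [isTree_iff_isTree_induce_compl_singleton (degree_attachLeaf_self H u)]
  exact iff_of_eq (congrArg IsTree (comap_attachLeaf H u))

theorem attachLeaf_le {V : Type*} {v : V} {G : SimpleGraph V} {H : SimpleGraph {w // w ≠ v}}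
    {u : {w // w ≠ v}} :
    H.attachLeaf u ≤ G ↔ H ≤ G.comap Subtype.val ∧ G.Adj v u := by
  rw [attachLeaf, sup_le_iff, edge_le_iff]
  refine and_congr (map_le_iff_le_comap _ _ _) ?_
  simp [u.2.symm]

open scoped Classical in
theorem exists_eq_attachLeaf {V : Type*} [Fintype V] {v : V} {T : SimpleGraph V}
    (hv : T.degree v = 1) : ∃ (H : SimpleGraph {w // w ≠ v}) (u : {w // w ≠ v}),
      H.attachLeaf u = T := by
  obtain ⟨u, hvu, hu⟩ := degree_eq_one_iff_existsUnique_adj.mp hv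
  refine ⟨T.comap Subtype.val, ⟨u, hvu.ne'⟩, ext_of_comap_of_adj (comap_attachLeaf _ _) ?_⟩
  intro w
  rw [attachLeaf_adj_self]
  exact ⟨fun h => h ▸ hvu, hu w⟩

open scoped Classical in
theorem IsTree.degree_pos {V : Type*} [Fintype V] [Nontrivial V] {T : SimpleGraph V}
    (h : T.IsTree) (v : V) : 0 < T.degree v :=
  h.1.preconnected.degree_pos_of_nontrivial v

/-! ### The degree polynomial of spanning trees -/

open scoped Classical in
/-- The generating polynomial of the spanning trees of `G` by the degrees, lowered by one, of their
vertices. -/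
noncomputable def treePoly {V : Type*} [Fintype V] (G : SimpleGraph V) : MvPolynomial V ℚ :=
  ∑ T ∈ G.spanningTrees, ∏ v, X v ^ (T.degree v - 1)

theorem isHomogeneous_treePoly {V : Type*} [Fintype V] [Nontrivial V] (G : SimpleGraph V) :
    G.treePoly.IsHomogeneous (Fintype.card V - 2) := by
  classical
  refine IsHomogeneous.sum _ _ _ fun T hT => ?_
  rw [mem_spanningTrees] at hT
  have h := IsHomogeneous.prod Finset.univ (fun v => (X v ^ (T.degree v - 1) : MvPolynomial V ℚ))
    (fun v => T.degree v - 1) fun v _ => isHomogeneous_X_pow _ _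
  convert h
  -- The degree is 2(|V| - 1) - |V|; positive degrees make the truncated subtraction exact.
  have h1 : ∑ v, (T.degree v - 1) + ∑ _v : V, 1 = ∑ v, T.degree v := by
    rw [← Finset.sum_add_distrib]
    exact Finset.sum_congr rfl fun v _ => Nat.sub_add_cancel (hT.2.degree_pos v)
  have h2 := T.sum_degrees_eq_twice_card_edges
  have h3 := hT.2.card_edgeFinset
  simp at h1
  omega

theorem killCompl_X_of_ne {V : Type*} {v : V} (w : {w // w ≠ v}) :
    killCompl (R := ℚ) (Subtype.val_injective (p := (· ≠ v))) (X (w : V)) = X w := by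
  simpa using killCompl_rename_app (Subtype.val_injective (p := (· ≠ v)))
    (X w : MvPolynomial {w // w ≠ v} ℚ)

theorem killCompl_X_self {V : Type*} (v : V) :
    killCompl (R := ℚ) (Subtype.val_injective (p := (· ≠ v))) (X v) = 0 := by
  simp [killCompl]

open scoped Classical in
/-- The variables set to zero mark leaves, and removing a leaf leaves a spanning tree. -/
theorem killCompl_treePoly {V : Type*} [Fintype V] (hV : 3 ≤ Fintype.card V) (G : SimpleGraph V)
    (v : V) :
    killCompl (Subtype.val_injective (p := (· ≠ v))) G.treePoly =
      (∑ u ∈ Finset.univ.filter (fun u : {w // w ≠ v} => G.Adj v u), X u) *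
        (G.comap (Subtype.val : {w // w ≠ v} → V)).treePoly := by
  have : Nontrivial V := Fintype.one_lt_card_iff_nontrivial.1 (by omega)
  have : Nontrivial {w // w ≠ v} := Fintype.one_lt_card_iff_nontrivial.1 (by
    rw [Fintype.card_subtype_compl, Fintype.card_subtype_eq]; omega)
  have hkill (T : SimpleGraph V) : killCompl (Subtype.val_injective (p := (· ≠ v)))
      (∏ w, X w ^ (T.degree w - 1) : MvPolynomial V ℚ) =
        0 ^ (T.degree v - 1) * ∏ w : {w // w ≠ v}, X w ^ (T.degree w - 1) := by
    simp only [map_prod, map_pow]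
    rw [Fintype.prod_eq_mul_prod_subtype_ne _ v, killCompl_X_self]
    simp only [killCompl_X_of_ne]
  rw [treePoly, map_sum, treePoly, Finset.sum_mul_sum, ← Finset.sum_product']
  simp only [hkill]
  -- The factor `0 ^ (T.degree v - 1)` is 1 when `v` is a leaf and 0 otherwise.
  rw [← Finset.sum_filter_of_ne (p := fun T => T.degree v = 1)]
  · symm
    refine Finset.sum_bij (fun p _ => p.2.attachLeaf p.1) ?_ ?_ ?_ ?_
    · rintro ⟨u, H⟩ h
      simp only [Finset.mem_product, Finset.mem_filter, Finset.mem_univ, true_and,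
        mem_spanningTrees] at h ⊢
      exact ⟨⟨attachLeaf_le.2 ⟨h.2.1, h.1⟩, (isTree_attachLeaf _ _).2 h.2.2⟩,
        degree_attachLeaf_self _ _⟩
    · rintro ⟨u, H⟩ - ⟨u', H'⟩ - h
      dsimp only at h
      have h1 := comap_attachLeaf H u
      have h2 := (attachLeaf_adj_self H u u).2 rfl
      rw [h, comap_attachLeaf] at h1
      rw [h, attachLeaf_adj_self] at h2
      rw [h1, Subtype.ext h2]
    · intro T hT
      simp only [Finset.mem_filter, mem_spanningTrees] at hT
      obtain ⟨H, u, rfl⟩ := exists_eq_attachLeaf hT.2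
      refine ⟨(u, H), ?_, rfl⟩
      simp only [Finset.mem_product, Finset.mem_filter, Finset.mem_univ, true_and,
        mem_spanningTrees]
      exact ⟨(attachLeaf_le.1 hT.1.1).2, (attachLeaf_le.1 hT.1.1).1,
        (isTree_attachLeaf _ _).1 hT.1.2⟩
    · rintro ⟨u, H⟩ h
      simp only [Finset.mem_product, mem_spanningTrees] at h
      dsimp only
      rw [degree_attachLeaf_self, pow_zero, one_mul]
      have hu : (X u : MvPolynomial {w // w ≠ v} ℚ) = ∏ w, X w ^ (if w = u then 1 else 0) := by
        simp [Finset.prod_ite_eq']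
      rw [hu, ← Finset.prod_mul_distrib]
      refine Finset.prod_congr rfl fun w _ => ?_
      rw [← pow_add, degree_attachLeaf_coe]
      have := h.2.2.degree_pos w
      congr 1
      omega
  · intro T hT hne
    rw [mem_spanningTrees] at hT
    by_contra h
    have := hT.2.degree_pos v
    rw [zero_pow (by omega), zero_mul] at hne
    exact hne rfl

end SimpleGraph

open scoped Classical in
theorem MvPolynomial.killCompl_sum_X {V : Type*} [Fintype V] (v : V) (P : V → Prop)
    [DecidablePred P] :
    killCompl (R := ℚ) (Subtype.val_injective (p := (· ≠ v))) (∑ w with P w, X w) =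
      ∑ w ∈ Finset.univ.filter (fun w : {w // w ≠ v} => P w), X w := by
  rw [map_sum, Finset.sum_filter, Finset.sum_filter, Fintype.sum_eq_add_sum_subtype_ne _ v,
    SimpleGraph.killCompl_X_self, ite_self, zero_add]
  simp only [SimpleGraph.killCompl_X_of_ne]

open scoped Classical in
theorem Fintype.card_filter_eq_add_card_filter_subtype_ne {V : Type*} [Fintype V] (v : V)
    (P : V → Prop) [DecidablePred P] :
    (Finset.univ.filter P).card =
      (if P v then 1 else 0) + (Finset.univ.filter fun w : {w // w ≠ v} => P w).card := by
  rw [Finset.card_filter, Finset.card_filter, Fintype.sum_eq_add_sum_subtype_ne _ v]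

/-- A nonempty fiber contributes 1 + (size - 1), an empty one 0 + 0. Empty fibers must be allowed,
since deleting a vertex can empty its part. -/
theorem Fintype.card_image_add_sum_card_fiber_sub_one {V C : Type*} [Fintype V] [Fintype C]
    [DecidableEq C]
    (c : V → C) :
    (Finset.univ.image c).card + ∑ ℓ, ((Finset.univ.filter (c · = ℓ)).card - 1) =
      Fintype.card V := by
  have h1 : (Finset.univ.image c).card = ∑ ℓ, if ℓ ∈ Finset.univ.image c then 1 else 0 := by
    simp
  have h2 : Fintype.card V = ∑ ℓ, (Finset.univ.filter (c · = ℓ)).card :=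
    Finset.card_eq_sum_card_fiberwise (fun _ _ => Finset.mem_coe.2 (Finset.mem_univ _))
  rw [h1, h2, ← Finset.sum_add_distrib]
  refine Finset.sum_congr rfl fun ℓ _ => ?_
  split_ifs with h
  · have : 0 < (Finset.univ.filter (c · = ℓ)).card := by
      rw [Finset.card_pos]
      simpa [Finset.Nonempty] using h
    omega
  · have : (Finset.univ.filter (c · = ℓ)).card = 0 := by
      rw [Finset.card_eq_zero, Finset.filter_eq_empty_iff]
      simpa using h
    omega

/-! ### Factorization for complete multipartite graphs -/

namespace SimpleGraph

open scoped Classical in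
theorem spanningTrees_eq_singleton_top {V : Type*} [Fintype V] (hV : Fintype.card V = 2) :
    (⊤ : SimpleGraph V).spanningTrees = {⊤} := by
  have : Nontrivial V := Fintype.one_lt_card_iff_nontrivial.1 (by omega)
  ext T
  simp only [mem_spanningTrees, le_top, true_and, Finset.mem_singleton]
  constructor
  · intro h
    rw [eq_top_iff]
    intro x y hxy
    obtain ⟨z, hz⟩ := (T.degree_pos_iff_exists_adj x).1 (h.degree_pos x)
    by_cases hzy : z = y
    · exact hzy ▸ hz
    · have := Finset.card_le_univ {x, y, z}
      rw [Finset.card_eq_three.2 ⟨x, y, z, hxy, hz.ne, Ne.symm hzy, rfl⟩] at this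
      omega
  · rintro rfl
    exact ⟨connected_top, IsAcyclic.of_card_le_two (by simp [hV])⟩

open scoped Classical in
theorem treePoly_top_of_card_eq_two {V : Type*} [Fintype V] (hV : Fintype.card V = 2) :
    (⊤ : SimpleGraph V).treePoly = 1 := by
  rw [treePoly, spanningTrees_eq_singleton_top hV, Finset.sum_singleton]
  exact Finset.prod_eq_one fun v _ => by
    have : (⊤ : SimpleGraph V).degree v = 1 := by
      rw [← card_neighborFinset_eq_degree, neighborFinset_eq_filter]
      simp [Finset.filter_ne, hV]
    refine (congrArg (X v ^ ·) ?_).trans (pow_zero _)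
    convert Nat.sub_self 1
    convert this

theorem treePoly_bot {V : Type*} [Fintype V] [Nontrivial V] :
    (⊥ : SimpleGraph V).treePoly = 0 := by
  classical
  refine Finset.sum_eq_zero fun T hT => ?_
  obtain ⟨h, hT⟩ := mem_spanningTrees.1 hT
  obtain ⟨x⟩ := hT.1.nonempty
  obtain ⟨z, hz⟩ := (T.degree_pos_iff_exists_adj x).1 (hT.degree_pos x)
  exact absurd (h hz) (by simp)

/-- The degree generating polynomial of the spanning trees of the complete multipartite graph whose
parts are the fibers of `c`. -/
theorem treePoly_comap_top {V C : Type*} [Fintype V] [Fintype C] [DecidableEq C] (c : V → C)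
    (hk : 2 ≤ (Finset.univ.image c).card) :
    ((⊤ : SimpleGraph C).comap c).treePoly =
      (∑ v, X v) ^ ((Finset.univ.image c).card - 2) *
        ∏ ℓ, (∑ v with c v ≠ ℓ, X v) ^ ((Finset.univ.filter (c · = ℓ)).card - 1) := by
  classical
  obtain ⟨N, hN⟩ : ∃ N, Fintype.card V = N := ⟨_, rfl⟩
  have hkN : (Finset.univ.image c).card ≤ Fintype.card V := Finset.card_image_le
  induction N using Nat.strong_induction_on generalizing V with
  | _ N ih =>
  have hNt : Nontrivial V := Fintype.one_lt_card_iff_nontrivial.1 (by omega)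
  -- Base case: leaf removal needs at least two vertices to remain.
  by_cases hN2 : N = 2
  · have hinj : Function.Injective c := by
      have h : (Finset.univ.image c).card = (Finset.univ : Finset V).card := by
        rw [Finset.card_univ]
        omega
      simpa using Finset.card_image_iff.1 h
    have htop : (⊤ : SimpleGraph C).comap c = ⊤ := by
      ext x y
      simp [hinj.eq_iff]
    rw [htop, treePoly_top_of_card_eq_two (by omega), show (Finset.univ.image c).card - 2 = 0 by
      omega, pow_zero, one_mul]
    refine (Finset.prod_eq_one fun ℓ _ => ?_).symm
    rw [Nat.sub_eq_zero_of_le, pow_zero]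
    exact Finset.card_le_one.2 fun a ha b hb => hinj (by simp at ha hb; rw [ha, hb])
  have hN3 : 3 ≤ Fintype.card V := by omega
  rw [← sub_eq_zero]
  refine IsHomogeneous.eq_zero_of_killCompl (d := Fintype.card V - 2) ?_ (by omega) fun v => ?_
  · refine (isHomogeneous_treePoly _).sub ?_
    have h1 : ((∑ v, X v : MvPolynomial V ℚ) ^
        ((Finset.univ.image c).card - 2)).IsHomogeneous (1 * ((Finset.univ.image c).card - 2)) :=
      (IsHomogeneous.sum _ _ _ fun v _ => isHomogeneous_X _ _).pow _
    have h2 : (∏ ℓ, (∑ v with c v ≠ ℓ, X v : MvPolynomial V ℚ) ^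
        ((Finset.univ.filter (c · = ℓ)).card - 1)).IsHomogeneous
          (∑ ℓ, 1 * ((Finset.univ.filter (c · = ℓ)).card - 1)) :=
      IsHomogeneous.prod _ _ _ fun ℓ _ =>
        (IsHomogeneous.sum _ _ _ fun v _ => isHomogeneous_X _ _).pow _
    have h3 := Fintype.card_image_add_sum_card_fiber_sub_one c
    have h4 := h1.mul h2
    simp only [one_mul] at h4
    rwa [show (Finset.univ.image c).card - 2 + ∑ ℓ, ((Finset.univ.filter (c · = ℓ)).card - 1) =
      Fintype.card V - 2 by omega] at h4
  have hNt' : Nontrivial {w // w ≠ v} := Fintype.one_lt_card_iff_nontrivial.1 (by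
    rw [Fintype.card_subtype_compl, Fintype.card_subtype_eq]; omega)
  have hcard' : Fintype.card {w // w ≠ v} < N := by
    rw [Fintype.card_subtype_compl, Fintype.card_subtype_eq]; omega
  have hS : killCompl (R := ℚ) (Subtype.val_injective (p := (· ≠ v))) (∑ w, X w) = ∑ w, X w := by
    simpa using killCompl_sum_X v (fun _ => True)
  have hfib (ℓ : C) := Fintype.card_filter_eq_add_card_filter_subtype_ne v (c · = ℓ)
  have hcomap : ((⊤ : SimpleGraph C).comap c).comap (Subtype.val : {w // w ≠ v} → V) =
      (⊤ : SimpleGraph C).comap fun w : {w // w ≠ v} => c w := rfl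
  have hrec : killCompl (Subtype.val_injective (p := (· ≠ v)))
      ((⊤ : SimpleGraph C).comap c).treePoly =
        (∑ u ∈ Finset.univ.filter (fun u : {w // w ≠ v} => c u ≠ c v), X u) *
          ((⊤ : SimpleGraph C).comap fun w : {w // w ≠ v} => c w).treePoly := by
    rw [killCompl_treePoly hN3, hcomap]
    congr 2
    ext u
    simp [ne_comm]
  rw [map_sub, sub_eq_zero, hrec, map_mul, map_pow, map_prod, hS]
  simp only [map_pow, killCompl_sum_X v (fun w => c w ≠ _)]
  have hprod (ℓ : C) (hℓ : ℓ ∈ Finset.univ.erase (c v)) :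
      (∑ u ∈ Finset.univ.filter (fun u : {w // w ≠ v} => c u ≠ ℓ), X u : MvPolynomial {w // w ≠ v} ℚ) ^
          ((Finset.univ.filter fun w => c w = ℓ).card - 1) =
        (∑ u ∈ Finset.univ.filter (fun u : {w // w ≠ v} => c u ≠ ℓ), X u) ^
          ((Finset.univ.filter fun w : {w // w ≠ v} => c w = ℓ).card - 1) := by
    rw [hfib, if_neg (Finset.ne_of_mem_erase hℓ).symm, zero_add]
  rw [← Finset.mul_prod_erase _ _ (Finset.mem_univ (c v)), Finset.prod_congr rfl hprod, hfib,
    if_pos rfl, Nat.add_sub_cancel_left]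
  -- If `v` shares its part, the leaf factor restores the lost power of S - S_ℓ. If `v` is alone,
  -- the leaf factor is S and restores the power lost with the part.
  by_cases hv : ∃ w : {w // w ≠ v}, c w = c v
  · have himage : Finset.univ.image (fun w : {w // w ≠ v} => c w) = Finset.univ.image c := by
      obtain ⟨w, hw⟩ := hv
      ext ℓ
      simp only [Finset.mem_image, Finset.mem_univ, true_and]
      constructor
      · rintro ⟨x, rfl⟩
        exact ⟨x, rfl⟩
      · rintro ⟨x, rfl⟩
        by_cases hx : x = v
        · exact ⟨w, by rw [hw, hx]⟩
        · exact ⟨⟨x, hx⟩, rfl⟩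
    have hpos : 0 < (Finset.univ.filter fun w : {w // w ≠ v} => c w = c v).card := by
      obtain ⟨w, hw⟩ := hv
      exact Finset.card_pos.2 ⟨w, by simpa using hw⟩
    rw [ih _ hcard' (fun w : {w // w ≠ v} => c w) (by rwa [himage]) rfl Finset.card_image_le,
      himage, ← Finset.mul_prod_erase _ _ (Finset.mem_univ (c v))]
    obtain ⟨m, hm⟩ := Nat.exists_eq_succ_of_ne_zero hpos.ne'
    rw [hm, Nat.succ_sub_one, pow_succ]
    ring
  · push Not at hv
    have himage : Finset.univ.image (fun w : {w // w ≠ v} => c w) =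
        (Finset.univ.image c).erase (c v) := by
      ext ℓ
      simp only [Finset.mem_image, Finset.mem_univ, true_and, Finset.mem_erase]
      constructor
      · rintro ⟨x, rfl⟩
        exact ⟨hv x, x, rfl⟩
      · rintro ⟨hx, x, rfl⟩
        exact ⟨⟨x, fun h => hx (h ▸ rfl)⟩, rfl⟩
    have hcardimage : (Finset.univ.image fun w : {w // w ≠ v} => c w).card =
        (Finset.univ.image c).card - 1 := by
      rw [himage, Finset.card_erase_of_mem (by simp)]
    have hzero : (Finset.univ.filter fun w : {w // w ≠ v} => c w = c v).card = 0 := by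
      simpa [Finset.filter_eq_empty_iff] using hv
    have hSD : (∑ u ∈ Finset.univ.filter (fun u : {w // w ≠ v} => c u ≠ c v), X u : MvPolynomial {w // w ≠ v} ℚ) =
        ∑ u, X u := by
      rw [Finset.filter_true_of_mem fun u _ => hv u]
    rw [hzero, pow_zero, one_mul, hSD]
    by_cases hk3 : 3 ≤ (Finset.univ.image c).card
    · rw [ih _ hcard' (fun w : {w // w ≠ v} => c w) (by omega) rfl Finset.card_image_le,
        ← Finset.mul_prod_erase _ _ (Finset.mem_univ (c v)), hzero, hcardimage]
      obtain ⟨m, hm⟩ := Nat.exists_eq_add_of_le hk3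
      rw [show (Finset.univ.image c).card - 2 = m + 1 by omega,
        show (Finset.univ.image c).card - 1 - 2 = m by omega, pow_succ]
      simp only [Nat.zero_sub, pow_zero, one_mul]
      ring
    -- Only one part remains: G - v has no edges, and on the right the factor of that part is an
    -- empty sum to a positive power.
    · obtain ⟨w⟩ := hNt'.to_nonempty
      have hw (u : {w // w ≠ v}) : c u = c w :=
        Finset.card_le_one.1 (by omega : (Finset.univ.image fun w : {w // w ≠ v} => c w).card ≤ 1)
          _ (by simp) _ (by simp)
      have hbot : (⊤ : SimpleGraph C).comap (fun u : {w // w ≠ v} => c u) = ⊥ := by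
        ext x y
        simp [hw x, hw y]
      rw [hbot, treePoly_bot, mul_zero, Finset.prod_eq_zero (i := c w), mul_zero]
      · simpa using hv w
      · rw [Finset.filter_false_of_mem fun u _ => by simp [hw u], Finset.sum_empty, zero_pow]
        rw [Finset.filter_true_of_mem fun u _ => hw u, Finset.card_univ]
        have := Fintype.one_lt_card (α := {w // w ≠ v})
        omega

end SimpleGraph

/-! ### Sign averaging -/

/-- The number of functions to `Bool` that take the value `true` exactly `r` times. -/
theorem Fintype.card_filter_card_filter_eq_true {α : Type*} [Fintype α] [DecidableEq α] (r : ℕ) :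
    (Finset.univ.filter fun f : α → Bool => (Finset.univ.filter (f · = true)).card = r).card =
      (Fintype.card α).choose r := by
  rw [← Finset.card_univ, ← Finset.card_powersetCard]
  refine Finset.card_nbij' (fun f => Finset.univ.filter (f · = true)) (fun s i => decide (i ∈ s))
    ?_ ?_ ?_ ?_
  · intro f hf
    simpa [Finset.mem_powersetCard] using hf
  · intro s hs
    simpa [Finset.mem_powersetCard] using hs
  · intro f _
    simp
  · intro s _
    simp

open Finset in
/-- Summing over two-valued functions on a disjoint union by the number of `true` values on each
summand. -/
theorem Fintype.sum_sigma_bool_eq_sum_choose {ι : Type*} [Fintype ι] [DecidableEq ι] (n : ι → ℕ)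
    (F : (ι → ℕ) → ℚ) :
    ∑ ε : (Σ ℓ, Fin (n ℓ)) → Bool, F (fun ℓ => (univ.filter fun i => ε ⟨ℓ, i⟩ = true).card) =
      ∑ r ∈ Fintype.piFinset fun ℓ => Icc 0 (n ℓ), (∏ ℓ, ((n ℓ).choose (r ℓ) : ℚ)) * F r := by
  refine (Fintype.sum_equiv (Equiv.piCurry fun (ℓ : ι) (_ : Fin (n ℓ)) => Bool) _
    (fun f => F fun ℓ => (univ.filter fun i => f ℓ i = true).card) fun ε => rfl).trans ?_
  rw [← sum_fiberwise_of_maps_to (t := Fintype.piFinset fun ℓ => Icc 0 (n ℓ))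
    (g := fun (f : ∀ ℓ, Fin (n ℓ) → Bool) ℓ => (univ.filter fun i => f ℓ i = true).card)]
  · refine Finset.sum_congr rfl fun r _ => ?_
    rw [Finset.sum_congr rfl fun f hf => (congrArg F (mem_filter.1 hf).2 : _ = F r), sum_const,
      nsmul_eq_mul]
    congr 1
    rw [← Nat.cast_prod]
    congr 1
    have : (univ.filter fun f : ∀ ℓ, Fin (n ℓ) → Bool =>
        (fun ℓ => (univ.filter fun i => f ℓ i = true).card) = r) =
        Fintype.piFinset fun ℓ => univ.filter fun f : Fin (n ℓ) → Bool =>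
          (univ.filter (f · = true)).card = r ℓ := by
      ext f
      simp [funext_iff]
    rw [this, Fintype.card_piFinset]
    exact Finset.prod_congr rfl fun ℓ _ => by
      rw [Fintype.card_filter_card_filter_eq_true, Fintype.card_fin]
  · intro f _
    simp only [Fintype.mem_piFinset, mem_Icc, zero_le, true_and]
    exact fun ℓ => (card_le_univ _).trans (Fintype.card_fin _).le

theorem Finset.sum_ite_one_neg_one {α : Type*} (s : Finset α) (P : α → Prop) [DecidablePred P] :
    ∑ i ∈ s, (if P i then 1 else -1 : ℚ) = 2 * (s.filter P).card - s.card := by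
  have h := s.card_filter_add_card_filter_not P
  rw [Finset.sum_ite, Finset.sum_const, Finset.sum_const, ← h]
  simp
  ring

namespace SimpleGraph

open scoped Classical in
theorem numOddSpanningTrees_eq_card_filter {V : Type*} [Fintype V] (G : SimpleGraph V) :
    numOddSpanningTrees G = (G.spanningTrees.filter fun T => ∀ v, Odd (T.degree v)).card := by
  rw [numOddSpanningTrees, ← Set.ncard_coe_finset]
  congr 1
  ext T
  have (v : V) : (T.neighborSet v).ncard = T.degree v := by
    rw [Set.ncard_eq_toFinset_card', ← card_neighborFinset_eq_degree, neighborFinset]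
  simp [this, and_assoc]

/-- Averaging the degree generating polynomial over all signs selects the odd spanning trees. -/
theorem sum_eval_treePoly {V : Type*} [Fintype V] [DecidableEq V] [Nontrivial V]
    (G : SimpleGraph V) :
    ∑ ε : V → Bool, eval (fun v => if ε v = true then (1 : ℚ) else -1) G.treePoly =
      2 ^ Fintype.card V * numOddSpanningTrees G := by
  classical
  have hT (T : SimpleGraph V) (h : T.IsTree) :
      ∑ ε : V → Bool, ∏ v, (if ε v = true then (1 : ℚ) else -1) ^ (T.degree v - 1) =
        if ∀ v, Odd (T.degree v) then 2 ^ Fintype.card V else 0 := by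
    -- The sum over signs factors as ∏ (1 + (-1)^(deg v - 1)).
    have := Finset.prod_univ_sum (fun _ : V => (Finset.univ : Finset Bool))
      fun v b => (if b = true then (1 : ℚ) else -1) ^ (T.degree v - 1)
    rw [Fintype.piFinset_univ] at this
    rw [← this]
    simp only [Fintype.sum_bool, if_true, one_pow, Bool.false_eq_true, if_false]
    split_ifs with hodd
    · rw [Finset.prod_congr rfl fun v _ => by
        rw [(Nat.Odd.sub_odd (hodd v) odd_one).neg_one_pow, one_add_one_eq_two]]
      simp
    · push Not at hodd
      obtain ⟨v, hv⟩ := hodd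
      refine Finset.prod_eq_zero (Finset.mem_univ v) ?_
      rw [Nat.not_odd_iff_even] at hv
      rw [(Nat.Even.sub_odd (h.degree_pos v) hv odd_one).neg_one_pow, add_neg_cancel]
  simp only [treePoly, map_sum, map_prod, map_pow, eval_X]
  rw [Finset.sum_comm, Finset.sum_congr rfl fun T hT' => hT T (mem_spanningTrees.1 hT').2,
    ← Finset.sum_filter, Finset.sum_const, nsmul_eq_mul, numOddSpanningTrees_eq_card_filter,
    mul_comm]

end SimpleGraph

theorem mainTheorem2 (k : ℕ) (hk : 2 ≤ k) (n : Fin k → ℕ) (hpos : ∀ ℓ, 1 ≤ n ℓ)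
    (hn : Even (∑ ℓ, n ℓ)) :
    (numOddSpanningTrees (SimpleGraph.completeMultipartiteGraph (fun ℓ => Fin (n ℓ))) : ℚ) =
      1 / 2 ^ (∑ ℓ, n ℓ) *
        ∑ r ∈ Fintype.piFinset (fun ℓ => Finset.Icc 0 (n ℓ)),
          (let m : Fin k → ℚ := fun ℓ => 2 * (r ℓ : ℚ) - (n ℓ : ℚ)
           let M : ℚ := ∑ ℓ, m ℓ
           (∏ ℓ, ((n ℓ).choose (r ℓ) : ℚ)) * (∏ ℓ, (M - m ℓ) ^ (n ℓ - 1)) * M ^ (k - 2)) := by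
  have himage : Finset.univ.image (Sigma.fst : (Σ ℓ, Fin (n ℓ)) → Fin k) = Finset.univ := by
    ext ℓ
    simpa using ⟨⟨0, hpos ℓ⟩⟩
  have hfiber (ℓ : Fin k) :
      (Finset.univ.filter fun v : Σ ℓ, Fin (n ℓ) => v.1 = ℓ).card = n ℓ := by
    rw [Finset.card_filter, Fintype.sum_sigma]
    simp [apply_ite Finset.card]
  have hcard : Fintype.card (Σ ℓ, Fin (n ℓ)) = ∑ ℓ, n ℓ := by simp
  have hNt : Nontrivial (Σ ℓ, Fin (n ℓ)) :=
    ⟨⟨⟨0, by omega⟩, ⟨0, hpos _⟩⟩, ⟨⟨1, by omega⟩, ⟨0, hpos _⟩⟩, by simp⟩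
  have hsum := SimpleGraph.sum_eval_treePoly
    (SimpleGraph.completeMultipartiteGraph (fun ℓ => Fin (n ℓ)))
  rw [SimpleGraph.completeMultipartiteGraph, SimpleGraph.treePoly_comap_top _
    (by rwa [himage, Finset.card_univ, Fintype.card_fin]), himage, hcard] at hsum
  rw [one_div, eq_inv_mul_iff_mul_eq₀ (by positivity), SimpleGraph.completeMultipartiteGraph,
    ← hsum]
  simp only [mul_assoc]
  rw [← Fintype.sum_sigma_bool_eq_sum_choose n fun r =>
    (∏ ℓ, ((∑ ℓ', (2 * (r ℓ' : ℚ) - n ℓ')) - (2 * (r ℓ : ℚ) - n ℓ)) ^ (n ℓ - 1)) *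
      (∑ ℓ', (2 * (r ℓ' : ℚ) - n ℓ')) ^ (k - 2)]
  refine Finset.sum_congr rfl fun ε _ => ?_
  have hpart (ℓ : Fin k) : ∑ i : Fin (n ℓ), (if ε ⟨ℓ, i⟩ = true then (1 : ℚ) else -1) =
      2 * (Finset.univ.filter fun i => ε ⟨ℓ, i⟩ = true).card - n ℓ := by
    rw [Finset.sum_ite_one_neg_one, Finset.card_univ, Fintype.card_fin]
  simp only [← hpart]
  rw [map_mul, map_pow, map_prod, mul_comm]
  simp only [map_pow, map_sum, eval_X, hfiber, Finset.card_univ, Fintype.card_fin]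
  rw [Fintype.sum_sigma]
  congr 1
  refine Finset.prod_congr rfl fun ℓ _ => ?_
  congr 1
  -- The signs outside part ℓ sum to M - m_ℓ.
  rw [Finset.sum_filter, Fintype.sum_sigma, eq_sub_iff_add_eq,
    ← Finset.add_sum_erase _ (fun ℓ' => ∑ i : Fin (n ℓ'), _) (Finset.mem_univ ℓ),
    ← Finset.add_sum_erase _ _ (Finset.mem_univ ℓ)]
  simp only [ne_eq, not_true_eq_false, if_false, Finset.sum_const_zero, zero_add]
  rw [add_comm]
  congr 1
  refine Finset.sum_congr rfl fun ℓ' hℓ' => ?_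
  simp [Finset.ne_of_mem_erase hℓ']
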